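/- **Setting.** Let $\mathcal M=(S,s_0,\mathcal A,\mathcal P,\mathcal{AP},\mathcal L,\mathcal R)$ be a finite Markov decision process with nonempty sets $\mathcal A(s)$ of available actions, labelling $\mathcal L:S\to 2^{\mathcal{AP}}$ and reward $\mathcal R:S\times\mathcal A\to\mathbb R$. A policy is a sequence $\pi=(d_1,d_2,\dots)$ of randomized decision rules, where $d_t(s,\cdot)$ is a probability distribution on $\mathcal A(s)$; $\mu^\pi_t(s,a)$ is the probability of being in $s$ and taking $a$ at stage $t$ when starting in $s_0$ and following $\pi$. An incentive design is a sequence $\Gamma=(\gamma_1,\gamma_2,\dots)$ of functions $\gamma_t:S\times\mathcal A\to[0,\infty)$. Fix a decision horizon $N\ge 1$. A policy $\pi=(\pi_0,\pi_1,\dots)$, written as a sequence of $N$-stage blocks, is an *optimal policy of the agent under $\Gamma$* if for every $k\ge0$ the block $\pi_k$ maximizes, among all $N$-stage policies and from every starting state $s\in S$ simultaneously, $$\mathbb E_s\Big[\sum_{t=1}^N\big(\mathcal R(S_t,A_t)+\gamma_{kN+t}(S_t,A_t)\big)\Big].$$ Given an objective (a set of state sequences), $\Gamma$ is *feasible* if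 every optimal policy of the agent under $\Gamma$ realizes the objective, from the initial state, with the maximum probability over all policies. The *cost* of $\Gamma$ is the supremum of $\mathbb E_{s_0}^{\pi}\big[\sum_{t\ge1}\gamma_t(S_t,A_t)\big]$ over the optimal policies $\pi$ of the agent under $\Gamma$. For $\overline\epsilon>0$, $\Gamma$ is *$\overline\epsilon$-optimal* if it is feasible, its cost is finite, and its cost is at most $\overline\epsilon$ more than the infimum of the costs of all feasible designs. These notions apply to any finite MDP with an objective. Let $\varphi$ be a syntactically co-safe LTL formula over $\mathcal{AP}$ and $A_\varphi=(\mathcal Q,q_0,2^{\mathcal{AP}},\delta,\mathcal F)$ a deterministic finite automaton such that an infinite word satisfies $\varphi$ if and only if $A_\varphi$ accepts one of its finite prefixes. The objective on $\mathcal M$ is that the word $\mathcal L(s_0)\mathcal L(s_1)\cdots$ of the path satisfies $\varphi$. The expanded MDP $\overline{\mathcal M}$ has states $\overline S=S\times\{1,\dots,N\}$, initial state $\overline s_0=(s_0,1)$, and the transitions of $\mathcal M$ in the first component, while the second component increases by $1$ at each stage and returns from $N$ to $1$; labels, rewards and available actions are those of the first component. The product MDP $\mathcal M_p$ has states $\overline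 S\times\mathcal Q$, initial state $(\overline s_0,\delta(q_0,\mathcal L(s_0)))$, and moves from $(s,q)$ under $a$ to $(s',\delta(q,\overline{\mathcal L}(s')))$ with probability $\overline{\mathcal P}_{s,a,s'}$, with the rewards and available actions of $\overline{\mathcal M}$; the objective on $\mathcal M_p$ is to reach $\overline S\times\mathcal F$. The agent with the same horizon $N$ acts on $\mathcal M_p$. For a policy $\pi$ of $\mathcal M_p$, $s\in\overline S$ and $t\ge1$ put $M^\pi_{s,t}=\{q\in\mathcal Q:\sum_{a}\mu_t^\pi((s,q),a)>0\}$. **Theorem.** Let $\overline\epsilon>0$. If there exists an $\overline\epsilon$-optimal incentive design on $\mathcal M_p$ under which the agent has an optimal policy $\pi$ with $|M^\pi_{s,t}|\le1$ for all $s\in\overline S$ and all $t\ge1$, then there exists an $\overline\epsilon$-optimal incentive design on $\mathcal M$. -/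

import Mathlib

open scoped NNReal ENNReal

noncomputable section

namespace IncentiveDesign

/-! ### Markov decision processes, policies, occupation probabilities -/

/-- A Markov decision process with state set `S`, action set `A` and atomic propositions `AP`
(finiteness of `S` and `A` is carried by the type class arguments). -/
structure MDP (S A AP : Type*) [Fintype S] where
  /-- initial state -/
  init : S
  /-- actions available in a state -/
  avail : S → Finset A
  avail_nonempty : ∀ s, (avail s).Nonempty
  /-- transition function `P(s, a, s')` -/
  trans : S → A → S → ℝ
  trans_mem : ∀ s a s', trans s a s' ∈ Set.Icc (0 : ℝ) 1
  sum_trans : ∀ s, ∀ a ∈ avail s, ∑ s', trans s a s' = 1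
  /-- labelling function -/
  label : S → Set AP
  /-- reward function -/
  reward : S → A → ℝ

variable {S A AP Q : Type*} [Fintype S] [Fintype Q]

/-- A (randomized) decision rule: in each state, a probability distribution on the available
actions. -/
structure DecisionRule (M : MDP S A AP) where
  prob : S → A → ℝ
  prob_mem : ∀ s a, prob s a ∈ Set.Icc (0 : ℝ) 1
  prob_eq_zero : ∀ s, ∀ a ∉ M.avail s, prob s a = 0
  sum_prob : ∀ s, ∑ a ∈ M.avail s, prob s a = 1

/-- An infinite-stage policy. Stages `1, 2, 3, …` of the process are indexed by `0, 1, 2, …`: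
`π t` is the decision rule used at stage `t + 1`. -/
abbrev Policy (M : MDP S A AP) := ℕ → DecisionRule M

open Classical in
/-- `occupancy M π s₀ t s a` is the probability of being in state `s` and taking the action `a` at
stage `t + 1` when the process starts in `s₀` at stage `1` and the policy `π` is followed. -/
def occupancy (M : MDP S A AP) (π : Policy M) (s₀ : S) : ℕ → S → A → ℝ
  | 0, s, a => (π 0).prob s a * (if s = s₀ then 1 else 0)
  | t + 1, s', a' =>
      ∑ s, ∑ a ∈ M.avail s, M.trans s a s' * occupancy M π s₀ t s a * (π (t + 1)).prob s' a'

/-! ### The probability measure on paths -/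

/-- Distribution of the successor of the state `s` when the decision rule `d` is used. -/
def nextState (M : MDP S A AP) (d : DecisionRule M) (s : S) : PMF S :=
  PMF.ofFintype (fun s' => ENNReal.ofReal (∑ a ∈ M.avail s, d.prob s a * M.trans s a s')) (by
    have h0 : ∀ s' ∈ (Finset.univ : Finset S),
        0 ≤ ∑ a ∈ M.avail s, d.prob s a * M.trans s a s' := fun s' _ =>
      Finset.sum_nonneg fun a _ => mul_nonneg (d.prob_mem s a).1 (M.trans_mem s a s').1
    rw [← ENNReal.ofReal_sum_of_nonneg h0, Finset.sum_comm]
    have h1 : ∑ a ∈ M.avail s, ∑ s', d.prob s a * M.trans s a s' = 1 := by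
      rw [← d.sum_prob s]
      refine Finset.sum_congr rfl fun a ha => ?_
      rw [← Finset.mul_sum, M.sum_trans s a ha, mul_one]
    rw [h1, ENNReal.ofReal_one])

section PathMeasure

variable [MeasurableSpace S] [DiscreteMeasurableSpace S]

/-- The transition kernel of the state process from index `t` to index `t + 1`, as a function of
the finite path fragment seen so far. -/
def pathKernel (M : MDP S A AP) (π : Policy M) (t : ℕ) :
    ProbabilityTheory.Kernel ((i : Finset.Iic t) → (fun _ : ℕ => S) i) S :=
  (ProbabilityTheory.Kernel.ofFunOfCountable
    (fun s : S => (nextState M (π t) s).toMeasure)).comap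
      (fun h : (i : Finset.Iic t) → (fun _ : ℕ => S) i => h ⟨t, Finset.mem_Iic.2 le_rfl⟩)
      (measurable_pi_apply _)

instance (M : MDP S A AP) (π : Policy M) (t : ℕ) :
    ProbabilityTheory.IsMarkovKernel (pathKernel M π t) := by
  have : ProbabilityTheory.IsMarkovKernel (ProbabilityTheory.Kernel.ofFunOfCountable
      (fun s : S => (nextState M (π t) s).toMeasure)) :=
    ⟨fun s => PMF.toMeasure.isProbabilityMeasure (nextState M (π t) s)⟩
  unfold pathKernel
  infer_instance

/-- The law of the state path `s₀ s₁ s₂ …` generated from the initial state under `π`. -/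
def pathMeasure (M : MDP S A AP) (π : Policy M) : MeasureTheory.Measure (ℕ → S) :=
  ProbabilityTheory.Kernel.traj (X := fun _ : ℕ => S) (fun t => pathKernel M π t) 0
    (fun _ => M.init)

end PathMeasure

/-- The probability that the path generated under `π` lies in the set `E` of state sequences;
the finite set of states carries the discrete σ-algebra. -/
def pathProb (M : MDP S A AP) (π : Policy M) (E : Set (ℕ → S)) : ℝ≥0∞ :=
  letI : MeasurableSpace S := ⊤
  haveI : DiscreteMeasurableSpace S := ⟨fun _ => trivial⟩
  pathMeasure M π E

/-! ### Incentive designs and the principal's problem -/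

/-- An incentive design: `Γ t s a` is the incentive offered at stage `t + 1`. -/
abbrev Incentives (S A : Type*) := ℕ → S → A → ℝ≥0

/-- The agent's `k`-th objective: the expected total reward plus incentives over `N` stages, from
the state `s`, with the incentives of the stages `kN + 1, …, kN + N`. It depends only on the first
`N` decision rules of `π`, i.e. on an `N`-stage policy. -/
def objective (M : MDP S A AP) (N : ℕ) (Γ : Incentives S A) (k : ℕ) (π : Policy M) (s : S) : ℝ :=
  ∑ t ∈ Finset.range N, ∑ s', ∑ a ∈ M.avail s',
    occupancy M π s t s' a * (M.reward s' a + (Γ (k * N + t) s' a : ℝ))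

/-- `π = (π₀, π₁, …)` is an optimal policy of the agent under `Γ`: for each `k`, its `k`-th block
of `N` decision rules maximizes the `k`-th objective from every state, among all `N`-stage
policies. -/
def AgentOptimal (M : MDP S A AP) (N : ℕ) (Γ : Incentives S A) (π : Policy M) : Prop :=
  ∀ k s, ∀ σ : Policy M, objective M N Γ k σ s ≤ objective M N Γ k (fun t => π (k * N + t)) s

/-- The expected total incentive paid by the principal when the agent follows `π`. -/
def cost (M : MDP S A AP) (Γ : Incentives S A) (π : Policy M) : ℝ≥0∞ :=
  ∑' t, ∑ s, ∑ a ∈ M.avail s, ENNReal.ofReal (occupancy M π M.init t s a) * (Γ t s a : ℝ≥0∞)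

/-- The incentive design `Γ` is feasible for the principal's objective `E` (a set of state
sequences): every optimal policy of the agent under `Γ` realizes `E` with the maximum probability
over all policies. -/
def Feasible (M : MDP S A AP) (N : ℕ) (E : Set (ℕ → S)) (Γ : Incentives S A) : Prop :=
  ∀ π, AgentOptimal M N Γ π → ∀ σ : Policy M, pathProb M σ E ≤ pathProb M π E

/-- The cost that `Γ` guarantees to the principal, whichever optimal policy the agent uses. -/
def designCost (M : MDP S A AP) (N : ℕ) (Γ : Incentives S A) : ℝ≥0∞ :=
  ⨆ (π : Policy M) (_ : AgentOptimal M N Γ π), cost M Γ π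

/-- The optimal value (infimum of the costs) of the principal's problem. -/
def optimalCost (M : MDP S A AP) (N : ℕ) (E : Set (ℕ → S)) : ℝ≥0∞ :=
  ⨅ (Γ : Incentives S A) (_ : Feasible M N E Γ), designCost M N Γ

/-- `Γ` is an `ε`-optimal incentive design: it is feasible, its cost is finite, and its cost is
within `ε` of the optimal value. -/
def IsEpsOptimal (M : MDP S A AP) (N : ℕ) (E : Set (ℕ → S)) (ε : ℝ) (Γ : Incentives S A) : Prop :=
  Feasible M N E Γ ∧ designCost M N Γ ≠ ∞ ∧
    designCost M N Γ ≤ optimalCost M N E + ENNReal.ofReal ε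

/-! ### Syntactically co-safe LTL and its automata -/

/-- Syntactically co-safe LTL formulae over the atomic propositions `AP`. -/
inductive ScLTL (AP : Type*) where
  | tt : ScLTL AP
  | atom : AP → ScLTL AP
  | natom : AP → ScLTL AP
  | and : ScLTL AP → ScLTL AP → ScLTL AP
  | or : ScLTL AP → ScLTL AP → ScLTL AP
  | next : ScLTL AP → ScLTL AP
  | eventually : ScLTL AP → ScLTL AP
  | until : ScLTL AP → ScLTL AP → ScLTL AP

/-- `φ.Sat w`: the infinite word `w` over `2^AP` satisfies `φ`. -/
def ScLTL.Sat : ScLTL AP → (ℕ → Set AP) → Prop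
  | .tt, _ => True
  | .atom p, w => p ∈ w 0
  | .natom p, w => p ∉ w 0
  | .and φ ψ, w => φ.Sat w ∧ ψ.Sat w
  | .or φ ψ, w => φ.Sat w ∨ ψ.Sat w
  | .next φ, w => φ.Sat (fun i => w (i + 1))
  | .eventually φ, w => ∃ j, φ.Sat (fun i => w (i + j))
  | .until φ ψ, w => ∃ j, ψ.Sat (fun i => w (i + j)) ∧ ∀ k < j, φ.Sat (fun i => w (i + k))

/-- `D` is a DFA for `φ`: an infinite word satisfies `φ` if and only if one of its finite prefixes
is accepted by `D`. -/
def IsDFAOf (D : DFA (Set AP) Q) (φ : ScLTL AP) : Prop :=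
  ∀ w : ℕ → Set AP, φ.Sat w ↔ ∃ n, D.eval ((List.range n).map w) ∈ D.accept

/-- The state sequences of `M` whose words satisfy `φ`. -/
def satPaths (M : MDP S A AP) (φ : ScLTL AP) : Set (ℕ → S) :=
  {ω | φ.Sat (fun i => M.label (ω i))}

/-- The state sequences that visit the set `B`. -/
def reachPaths (B : Set S) : Set (ℕ → S) := {ω | ∃ t, ω t ∈ B}

/-! ### The expanded MDP and the product MDP -/

/-- `n'` is the cyclic successor of `n` (the counter values `1, …, N` are indexed by
`0, …, N - 1`). -/
def CounterStep {N : ℕ} (n n' : Fin N) : Prop :=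
  (n.val + 1 < N ∧ n'.val = n.val + 1) ∨ (n.val + 1 = N ∧ n'.val = 0)

lemma CounterStep.exists_iff_eq {N : ℕ} (n : Fin N) : ∃ m, ∀ n', CounterStep n n' ↔ n' = m := by
  by_cases h : n.val + 1 < N
  · exact ⟨⟨n.val + 1, h⟩, fun n' => by simp only [CounterStep, Fin.ext_iff]; omega⟩
  · exact ⟨⟨0, by omega⟩, fun n' => by simp only [CounterStep, Fin.ext_iff]; omega⟩

open Classical in
/-- The expanded MDP: the position inside the agent's planning horizon is added to the state. -/
def expanded (M : MDP S A AP) (N : ℕ) [NeZero N] : MDP (S × Fin N) A AP where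
  init := (M.init, 0)
  avail x := M.avail x.1
  avail_nonempty x := M.avail_nonempty x.1
  trans x a x' := if CounterStep x.2 x'.2 then M.trans x.1 a x'.1 else 0
  trans_mem x a x' := by
    split_ifs
    · exact M.trans_mem _ _ _
    · simp
  sum_trans x a ha := by
    obtain ⟨m, hm⟩ := CounterStep.exists_iff_eq x.2
    simp only [hm, Fintype.sum_prod_type, Finset.sum_ite_eq', Finset.mem_univ, if_true]
    exact M.sum_trans x.1 a ha
  label x := M.label x.1
  reward x a := M.reward x.1 a

open Classical in
/-- The product of an MDP with a DFA that reads the labels of the visited states. -/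
def product (M : MDP S A AP) (D : DFA (Set AP) Q) : MDP (S × Q) A Q where
  init := (M.init, D.step D.start (M.label M.init))
  avail x := M.avail x.1
  avail_nonempty x := M.avail_nonempty x.1
  trans x a x' := if x'.2 = D.step x.2 (M.label x'.1) then M.trans x.1 a x'.1 else 0
  trans_mem x a x' := by
    split_ifs
    · exact M.trans_mem _ _ _
    · simp
  sum_trans x a ha := by
    simp only [Fintype.sum_prod_type, Finset.sum_ite_eq', Finset.mem_univ,
      if_true]
    exact M.sum_trans x.1 a ha
  label x := {x.2}
  reward x a := M.reward x.1 a

/-- The accepting states of the product MDP. -/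
def acceptStates (S : Type*) (D : DFA (Set AP) Q) : Set (S × Q) := {x | x.2 ∈ D.accept}

/-- The memory states occupied with positive probability together with the state `s` at stage
`t + 1`, under a policy of the product MDP. -/
def occupiedMemory (M : MDP S A AP) (D : DFA (Set AP) Q) (π : Policy (product M D))
    (s : S) (t : ℕ) : Set Q :=
  {q | 0 < ∑ a ∈ M.avail s, occupancy (product M D) π (product M D).init t (s, q) a}

end IncentiveDesign

end

open scoped NNReal ENNReal

noncomputable section

namespace IncentiveDesign

variable {S A AP Q : Type*} [Fintype S] [Fintype Q]

/-! ### State distributions and expected stage rewards -/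

/-! The optimal cost is an infimum, so a feasible design of finite cost on `M` already forces an
`ε`-optimal one to exist (`exists_isEpsOptimal`). Feasibility and finite cost therefore suffice, and
these can be transferred from the product.

The product is `M` with a memory that is a deterministic function of the path (`IsMemoryExtension`).
The counter depends only on the stage, so the hypothesis on the occupied memory says that along `π`
the stage and the state of `M` determine the whole product state. Choose for each stage and state
one action in the support of `π` there. This gives a deterministic plan `d` on `M` that ignores the
memory. An agent's policy is optimal exactly when it uses only actions of zero Bellman gap wherever
a block can lead (`IsValueFn.optimal_iff`), so shrinking supports preserves optimality, and the plan
is what some optimal policy of the agent does on the product (`exists_plan`). By feasibility it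
reaches acceptance with maximal probability among all product policies, in particular among lifts of
policies of `M`. Lifting transports path laws (`map_pathMeasure`), so the plan is maximal on `M`.

On `M`, pay the planned action its Bellman gap in the incentive-free problem plus a bonus `(1/2)^t`,
and pay nothing else. The planned action becomes the unique best one (`AgentOptimal.eq_plan`), which
gives feasibility. For the cost, the expected gaps over a block telescope to the incentive-free
value minus the collected reward. On the product the agent could secure that value by ignoring
memory and incentives, so the incentives paid there in the block cover the difference
(`sum_gap_le`). The total is thus at most the finite product cost plus `∑ (1/2)^t = 2`. -/

/-- The probability of moving from `s` to `s'` when the decision rule `d` is used. -/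
def stepProb (M : MDP S A AP) (d : DecisionRule M) (s s' : S) : ℝ :=
  ∑ a ∈ M.avail s, d.prob s a * M.trans s a s'

lemma stepProb_nonneg (M : MDP S A AP) (d : DecisionRule M) (s s' : S) : 0 ≤ stepProb M d s s' :=
  Finset.sum_nonneg fun a _ => mul_nonneg (d.prob_mem s a).1 (M.trans_mem s a s').1

open Classical in
/-- The probability of being in `s` at stage `t + 1` when starting in `s₀`. -/
def stateProb (M : MDP S A AP) (π : Policy M) (s₀ : S) : ℕ → S → ℝ
  | 0, s => if s = s₀ then 1 else 0
  | t + 1, s' => ∑ s, stateProb M π s₀ t s * stepProb M (π t) s s'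

lemma stateProb_nonneg (M : MDP S A AP) (π : Policy M) (s₀ : S) (t : ℕ) (s : S) :
    0 ≤ stateProb M π s₀ t s := by
  induction t generalizing s with
  | zero => simp only [stateProb]; split_ifs <;> norm_num
  | succ t ih => exact Finset.sum_nonneg fun x _ => mul_nonneg (ih x) (stepProb_nonneg ..)

lemma occupancy_eq (M : MDP S A AP) (π : Policy M) (s₀ : S) (t : ℕ) (s : S) (a : A) :
    occupancy M π s₀ t s a = stateProb M π s₀ t s * (π t).prob s a := by
  induction t generalizing s a with
  | zero => simp only [occupancy, stateProb]; ring
  | succ t ih =>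
    simp only [occupancy, stateProb, stepProb, ih, Finset.mul_sum, Finset.sum_mul]
    exact Finset.sum_congr rfl fun x _ => Finset.sum_congr rfl fun b _ => by ring

lemma sum_occupancy (M : MDP S A AP) (π : Policy M) (s₀ : S) (t : ℕ) (s : S) :
    ∑ a ∈ M.avail s, occupancy M π s₀ t s a = stateProb M π s₀ t s := by
  simp only [occupancy_eq, ← Finset.mul_sum, (π t).sum_prob, mul_one]

lemma occupancy_nonneg (M : MDP S A AP) (π : Policy M) (s₀ : S) (t : ℕ) (s : S) (a : A) :
    0 ≤ occupancy M π s₀ t s a := by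
  rw [occupancy_eq]; exact mul_nonneg (stateProb_nonneg ..) ((π t).prob_mem s a).1

lemma occupancy_pos_iff (M : MDP S A AP) (π : Policy M) (s₀ : S) (t : ℕ) (s : S) (a : A) :
    0 < occupancy M π s₀ t s a ↔ 0 < stateProb M π s₀ t s ∧ 0 < (π t).prob s a := by
  rw [occupancy_eq]
  constructor
  · intro h
    have h1 := (stateProb_nonneg M π s₀ t s).lt_of_ne' (left_ne_zero_of_mul h.ne')
    exact ⟨h1, (pos_iff_pos_of_mul_pos h).1 h1⟩
  · exact fun h => mul_pos h.1 h.2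

lemma mem_avail_of_prob_pos {M : MDP S A AP} (d : DecisionRule M) {s : S} {a : A}
    (h : 0 < d.prob s a) : a ∈ M.avail s := by
  by_contra ha
  exact h.ne' (d.prob_eq_zero s a ha)

lemma DecisionRule.exists_prob_pos {M : MDP S A AP} (d : DecisionRule M) (s : S) :
    ∃ a, 0 < d.prob s a := by
  by_contra! h
  have h1 := d.sum_prob s
  have h2 := Finset.sum_nonpos fun a (_ : a ∈ M.avail s) => h a
  linarith

/-- The expectation of `f (S_{t+1}, A_{t+1})` when starting in `s₀`. -/
def expect (M : MDP S A AP) (π : Policy M) (s₀ : S) (t : ℕ) (f : S → A → ℝ) : ℝ :=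
  ∑ s, ∑ a ∈ M.avail s, occupancy M π s₀ t s a * f s a

section expect

variable (M : MDP S A AP) (π : Policy M) (s₀ : S) (t : ℕ)

lemma expect_add (f g : S → A → ℝ) :
    expect M π s₀ t (fun s a => f s a + g s a) = expect M π s₀ t f + expect M π s₀ t g := by
  simp only [expect, mul_add, Finset.sum_add_distrib]

lemma expect_sub (f g : S → A → ℝ) :
    expect M π s₀ t (fun s a => f s a - g s a) = expect M π s₀ t f - expect M π s₀ t g := by
  simp only [expect, mul_sub, Finset.sum_sub_distrib]

lemma expect_nonneg {f : S → A → ℝ} (hf : ∀ s, ∀ a ∈ M.avail s, 0 ≤ f s a) :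
    0 ≤ expect M π s₀ t f :=
  Finset.sum_nonneg fun s _ => Finset.sum_nonneg fun a ha =>
    mul_nonneg (occupancy_nonneg ..) (hf s a ha)

lemma expect_congr {f g : S → A → ℝ} (h : ∀ s a, 0 < occupancy M π s₀ t s a → f s a = g s a) :
    expect M π s₀ t f = expect M π s₀ t g := by
  refine Finset.sum_congr rfl fun s _ => Finset.sum_congr rfl fun a _ => ?_
  rcases (occupancy_nonneg M π s₀ t s a).eq_or_lt with h0 | h0
  · simp [← h0]
  · rw [h s a h0]

lemma eq_zero_of_expect_eq_zero {f : S → A → ℝ} (hf : ∀ s, ∀ a ∈ M.avail s, 0 ≤ f s a)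
    (h : expect M π s₀ t f = 0) {s : S} {a : A} (ho : 0 < occupancy M π s₀ t s a) :
    f s a = 0 := by
  have ha := mem_avail_of_prob_pos _ ((occupancy_pos_iff ..).1 ho).2
  have hnn : ∀ s, ∀ a ∈ M.avail s, 0 ≤ occupancy M π s₀ t s a * f s a := fun s a ha =>
    mul_nonneg (occupancy_nonneg ..) (hf s a ha)
  have h1 := (Finset.sum_eq_zero_iff_of_nonneg
    fun s _ => Finset.sum_nonneg (hnn s)).1 h s (Finset.mem_univ s)
  have h2 := (Finset.sum_eq_zero_iff_of_nonneg (hnn s)).1 h1 a ha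
  exact (mul_eq_zero.1 h2).resolve_left ho.ne'

lemma expect_state (V : S → ℝ) :
    expect M π s₀ t (fun s _ => V s) = ∑ s, stateProb M π s₀ t s * V s := by
  simp only [expect, ← Finset.sum_mul, sum_occupancy]

lemma expect_next (V : S → ℝ) :
    expect M π s₀ t (fun s a => ∑ s', M.trans s a s' * V s') =
      ∑ s, stateProb M π s₀ (t + 1) s * V s := by
  simp only [expect, stateProb, stepProb, occupancy_eq, Finset.mul_sum, Finset.sum_mul]
  rw [Finset.sum_comm (s := Finset.univ (α := S))]
  refine Finset.sum_congr rfl fun s _ => ?_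
  rw [Finset.sum_comm]
  exact Finset.sum_congr rfl fun s' _ => Finset.sum_congr rfl fun a _ => by ring

lemma sum_stateProb : ∑ s, stateProb M π s₀ t s = 1 := by
  induction t with
  | zero => classical simp [stateProb]
  | succ t ih =>
    have h1 := expect_next M π s₀ t 1
    have h2 : expect M π s₀ t (fun s a => ∑ s', M.trans s a s' * (1 : S → ℝ) s') =
        expect M π s₀ t (fun s _ => (1 : S → ℝ) s) := by
      refine expect_congr _ _ _ _ fun s a h => ?_
      simpa using M.sum_trans s a (mem_avail_of_prob_pos _ ((occupancy_pos_iff ..).1 h).2)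
    rw [h2, expect_state] at h1
    simp only [Pi.one_apply, mul_one] at h1
    rw [← h1, ih]

lemma expect_const (c : ℝ) : expect M π s₀ t (fun _ _ => c) = c := by
  rw [expect_state M π s₀ t (fun _ => c), ← Finset.sum_mul, sum_stateProb, one_mul]

/-- Chapman–Kolmogorov. It lets the process restart at the beginning of a block, where the agent's
objective is posed from every state. -/
lemma stateProb_add (k j : ℕ) (s : S) :
    stateProb M π s₀ (k + j) s =
      ∑ x, stateProb M π s₀ k x * stateProb M (fun i => π (k + i)) x j s := by
  induction j generalizing s with
  | zero => classical simp [stateProb]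
  | succ j ih =>
    rw [← add_assoc]
    simp only [stateProb, ih, Finset.sum_mul, Finset.mul_sum]
    rw [Finset.sum_comm]
    exact Finset.sum_congr rfl fun s' _ => Finset.sum_congr rfl fun a _ => by ring

lemma occupancy_add (k j : ℕ) (s : S) (a : A) :
    occupancy M π s₀ (k + j) s a =
      ∑ x, stateProb M π s₀ k x * occupancy M (fun i => π (k + i)) x j s a := by
  simp only [occupancy_eq, stateProb_add, Finset.sum_mul, mul_assoc]

lemma expect_stage_add (k j : ℕ) (f : S → A → ℝ) :
    expect M π s₀ (k + j) f =
      ∑ x, stateProb M π s₀ k x * expect M (fun i => π (k + i)) x j f := by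
  simp only [expect, occupancy_add, Finset.mul_sum, Finset.sum_mul]
  symm
  rw [Finset.sum_comm]
  refine Finset.sum_congr rfl fun s _ => ?_
  rw [Finset.sum_comm]
  exact Finset.sum_congr rfl fun a _ => Finset.sum_congr rfl fun x _ => by ring

/-- Telescoping of a potential `V` along the process, from stage `k` on. -/
lemma sum_expect_potential (k n : ℕ) (V : ℕ → S → ℝ) :
    ∑ j ∈ Finset.range n, expect M π s₀ (k + j)
        (fun s a => V j s - ∑ s', M.trans s a s' * V (j + 1) s') =
      ∑ s, stateProb M π s₀ k s * V 0 s - ∑ s, stateProb M π s₀ (k + n) s * V n s := by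
  induction n with
  | zero => simp
  | succ n ih =>
    rw [Finset.sum_range_succ, ih, expect_sub, expect_state M π s₀ (k + n) (V n),
      expect_next M π s₀ (k + n) (V (n + 1)), add_assoc]
    ring

end expect

/-! ### Value functions over a finite horizon -/

/-- `V` solves the optimality equations with stage rewards `r` over `N` stages. -/
structure IsValueFn (M : MDP S A AP) (r : ℕ → S → A → ℝ) (N : ℕ) (V : ℕ → S → ℝ) : Prop where
  terminal : ∀ s, V N s = 0
  le : ∀ j < N, ∀ s, ∀ a ∈ M.avail s, r j s a + ∑ s', M.trans s a s' * V (j + 1) s' ≤ V j s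
  exists_eq : ∀ j < N, ∀ s, ∃ a ∈ M.avail s,
    r j s a + ∑ s', M.trans s a s' * V (j + 1) s' = V j s

/-- Backward induction. Dropping the first stage shifts the rewards, so the induction must hold for
all `r`. -/
lemma exists_isValueFn (M : MDP S A AP) (N : ℕ) (r : ℕ → S → A → ℝ) :
    ∃ V, IsValueFn M r N V := by
  induction N generalizing r with
  | zero => exact ⟨fun _ _ => 0, fun _ => rfl, by simp, by simp⟩
  | succ N ih =>
    obtain ⟨V, hV⟩ := ih (fun j => r (j + 1))
    -- Stage `0` is the Bellman maximum against `V 0`, and stage `j + 1` is stage `j` of the shifted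
    -- problem.
    let U : ℕ → S → ℝ := fun j => Nat.casesOn j
      (fun s => (M.avail s).sup' (M.avail_nonempty s)
        fun a => r 0 s a + ∑ s', M.trans s a s' * V 0 s') V
    refine ⟨U, hV.terminal, ?_, ?_⟩
    · rintro (_ | j) hj s a ha
      · exact Finset.le_sup' (fun a => r 0 s a + ∑ s', M.trans s a s' * V 0 s') ha
      · exact hV.le j (by omega) s a ha
    · rintro (_ | j) hj s
      · obtain ⟨a, ha, h⟩ := Finset.exists_mem_eq_sup' (M.avail_nonempty s)
          (fun a => r 0 s a + ∑ s', M.trans s a s' * V 0 s')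
        exact ⟨a, ha, h.symm⟩
      · exact hV.exists_eq j (by omega) s

open Classical in
/-- The decision rule that takes the action `f s` in the state `s`. -/
def pureRule (M : MDP S A AP) (f : S → A) (hf : ∀ s, f s ∈ M.avail s) : DecisionRule M where
  prob s a := if a = f s then 1 else 0
  prob_mem s a := by split_ifs <;> simp
  prob_eq_zero s a ha := if_neg fun h => ha (by rw [h]; exact hf s)
  sum_prob s := by simp [hf]

lemma pureRule_pos {M : MDP S A AP} {f : S → A} {hf : ∀ s, f s ∈ M.avail s} {s : S} {a : A}
    (h : 0 < (pureRule M f hf).prob s a) : a = f s := by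
  by_contra hne
  simp [pureRule, hne] at h

/-- The expected total reward over `N` stages. -/
def totalReward (M : MDP S A AP) (r : ℕ → S → A → ℝ) (N : ℕ) (π : Policy M) (s : S) : ℝ :=
  ∑ t ∈ Finset.range N, expect M π s t (r t)

namespace IsValueFn

variable {M : MDP S A AP} {r : ℕ → S → A → ℝ} {N : ℕ} {V : ℕ → S → ℝ}

/-- The loss of optimality caused by an action. -/
def gap (M : MDP S A AP) (r : ℕ → S → A → ℝ) (V : ℕ → S → ℝ) (j : ℕ) (s : S) (a : A) : ℝ :=
  V j s - ∑ s', M.trans s a s' * V (j + 1) s' - r j s a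

lemma gap_nonneg (hV : IsValueFn M r N V) {j : ℕ} (hj : j < N) (s : S) :
    ∀ a ∈ M.avail s, 0 ≤ gap M r V j s a := fun a ha => by
  have := hV.le j hj s a ha
  unfold gap; linarith

/-- Telescoping the potential `V`: a policy falls short of the value by exactly its expected
accumulated gaps. -/
lemma totalReward_eq (hV : IsValueFn M r N V) (π : Policy M) (s : S) :
    totalReward M r N π s = V 0 s - ∑ j ∈ Finset.range N, expect M π s j (gap M r V j) := by
  have h := sum_expect_potential M π s 0 N V
  simp only [hV.terminal, mul_zero, Finset.sum_const_zero, sub_zero, zero_add] at h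
  have h0 : ∑ x, stateProb M π s 0 x * V 0 x = V 0 s := by
    classical simp [stateProb]
  rw [h0] at h
  unfold gap
  simp only [fun j => expect_sub M π s j (fun s a => V j s - ∑ s', M.trans s a s' * V (j + 1) s')
    (r j), Finset.sum_sub_distrib, h, totalReward]
  ring

lemma exists_greedy (hV : IsValueFn M r N V) :
    ∃ f : ℕ → S → A, (∀ t s, f t s ∈ M.avail s) ∧ ∀ j < N, ∀ s, gap M r V j s (f j s) = 0 := by
  have : ∀ j s, ∃ a, a ∈ M.avail s ∧ (j < N → gap M r V j s a = 0) := by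
    intro j s
    by_cases hj : j < N
    · obtain ⟨a, ha, h⟩ := hV.exists_eq j hj s
      exact ⟨a, ha, fun _ => by unfold gap; linarith⟩
    · obtain ⟨a, ha⟩ := M.avail_nonempty s
      exact ⟨a, ha, fun h => absurd h hj⟩
  choose f hf using this
  exact ⟨f, fun t s => (hf t s).1, fun j hj s => (hf j s).2 hj⟩

lemma totalReward_of_gap_eq_zero (hV : IsValueFn M r N V) {π : Policy M} {s : S}
    (h : ∀ j < N, ∀ s' a, 0 < occupancy M π s j s' a → gap M r V j s' a = 0) :
    totalReward M r N π s = V 0 s := by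
  rw [hV.totalReward_eq, Finset.sum_eq_zero, sub_zero]
  intro j hj
  rw [expect_congr M π s j (h j (Finset.mem_range.1 hj)), expect_const]

/-- A policy is optimal from every state if and only if it wastes nothing. -/
lemma optimal_iff (hV : IsValueFn M r N V) (π : Policy M) :
    (∀ s, ∀ σ : Policy M, totalReward M r N σ s ≤ totalReward M r N π s) ↔
      ∀ s, ∀ j < N, ∀ s' a, 0 < occupancy M π s j s' a → gap M r V j s' a = 0 := by
  have hnn : ∀ (σ : Policy M) s, ∀ j ∈ Finset.range N, 0 ≤ expect M σ s j (gap M r V j) :=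
    fun σ s j hj => expect_nonneg _ _ _ _ (hV.gap_nonneg (Finset.mem_range.1 hj))
  constructor
  · intro h s j hj s' a ho
    -- The greedy policy attains `V 0 s`. A policy at least as good has nonnegative expected gaps
    -- with sum at most `0`, so each of them vanishes.
    obtain ⟨f, hf, hg⟩ := hV.exists_greedy
    have h1 := h s (fun t => pureRule M (f t) (hf t))
    rw [hV.totalReward_of_gap_eq_zero, hV.totalReward_eq] at h1
    · have h2 := (Finset.sum_eq_zero_iff_of_nonneg (hnn π s)).1
        (le_antisymm (by linarith) (Finset.sum_nonneg (hnn π s))) j (Finset.mem_range.2 hj)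
      exact eq_zero_of_expect_eq_zero _ _ _ _ (hV.gap_nonneg hj) h2 ho
    · intro j hj s' a ho
      rw [pureRule_pos ((occupancy_pos_iff ..).1 ho).2, hg j hj]
  · intro h s σ
    rw [hV.totalReward_of_gap_eq_zero (h s), hV.totalReward_eq]
    linarith [Finset.sum_nonneg (hnn σ s)]

end IsValueFn

/-! ### Comparison of policies -/

lemma stateProb_pos_of_support {M : MDP S A AP} {π π' : Policy M}
    (h : ∀ t s a, 0 < (π' t).prob s a → 0 < (π t).prob s a) (s₀ : S) (t : ℕ) (s : S) :
    0 < stateProb M π' s₀ t s → 0 < stateProb M π s₀ t s := by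
  induction t generalizing s with
  | zero => exact id
  | succ t ih =>
    intro hs
    simp only [stateProb, stepProb, Finset.mul_sum] at hs ⊢
    obtain ⟨x, -, hx⟩ := Finset.exists_ne_zero_of_sum_ne_zero hs.ne'
    obtain ⟨a, ha, hxa⟩ := Finset.exists_ne_zero_of_sum_ne_zero hx
    have h1 := (stateProb_nonneg M π' s₀ t x).lt_of_ne' (left_ne_zero_of_mul hxa)
    have h2 := right_ne_zero_of_mul hxa
    have h3 := ((π' t).prob_mem x a).1.lt_of_ne' (left_ne_zero_of_mul h2)
    have h4 := (M.trans_mem x a s).1.lt_of_ne' (right_ne_zero_of_mul h2)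
    have hnn : ∀ x a, 0 ≤ stateProb M π s₀ t x * ((π t).prob x a * M.trans x a s) := fun x a =>
      mul_nonneg (stateProb_nonneg ..) (mul_nonneg ((π t).prob_mem x a).1 (M.trans_mem x a s).1)
    refine Finset.sum_pos' (fun x _ => Finset.sum_nonneg fun a _ => hnn x a)
      ⟨x, Finset.mem_univ x, Finset.sum_pos' (fun a _ => hnn x a) ⟨a, ha, ?_⟩⟩
    exact mul_pos (ih x h1) (mul_pos (h t x a h3) h4)

lemma occupancy_pos_of_support {M : MDP S A AP} {π π' : Policy M}
    (h : ∀ t s a, 0 < (π' t).prob s a → 0 < (π t).prob s a) {s₀ : S} {t : ℕ} {s : S} {a : A}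
    (ho : 0 < occupancy M π' s₀ t s a) : 0 < occupancy M π s₀ t s a := by
  rw [occupancy_pos_iff] at ho ⊢
  exact ⟨stateProb_pos_of_support h s₀ t s ho.1, h t s a ho.2⟩

/-- Policies that agree on the states visited by the first of them visit the same states. -/
lemma stateProb_congr {M : MDP S A AP} {π π' : Policy M} {s₀ : S}
    (h : ∀ t s, 0 < stateProb M π s₀ t s → (π t).prob s = (π' t).prob s) (t : ℕ) (s : S) :
    stateProb M π s₀ t s = stateProb M π' s₀ t s := by
  induction t generalizing s with
  | zero => rfl
  | succ t ih =>
    simp only [stateProb]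
    refine Finset.sum_congr rfl fun x _ => ?_
    rcases (stateProb_nonneg M π s₀ t x).eq_or_lt with h0 | h0
    · rw [← ih x, ← h0]; simp
    · rw [← ih x, stepProb, stepProb, h t x h0]

lemma occupancy_congr {M : MDP S A AP} {π π' : Policy M} {s₀ : S}
    (h : ∀ t s, 0 < stateProb M π s₀ t s → (π t).prob s = (π' t).prob s) (t : ℕ) :
    occupancy M π s₀ t = occupancy M π' s₀ t := by
  ext s a
  rw [occupancy_eq, occupancy_eq, ← stateProb_congr h]
  rcases (stateProb_nonneg M π s₀ t s).eq_or_lt with h0 | h0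
  · simp [← h0]
  · rw [h t s h0]

lemma cost_congr {M : MDP S A AP} {π π' : Policy M} (Γ : Incentives S A)
    (h : ∀ t s, 0 < stateProb M π M.init t s → (π t).prob s = (π' t).prob s) :
    cost M Γ π = cost M Γ π' := by
  simp only [cost, occupancy_congr h]

/-- A decision rule that only uses one action in the state `s` is pure there. -/
lemma prob_eq_pureRule {M : MDP S A AP} (d : DecisionRule M) {f : S → A}
    {hf : ∀ s, f s ∈ M.avail s} {s : S} (h : ∀ a, 0 < d.prob s a → a = f s) :
    d.prob s = (pureRule M f hf).prob s := by
  have h0 : ∀ a, a ≠ f s → d.prob s a = 0 := fun a ha => by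
    by_contra hne
    exact ha (h a ((d.prob_mem s a).1.lt_of_ne' hne))
  ext a
  by_cases ha : a = f s
  · have h1 := d.sum_prob s
    rw [Finset.sum_eq_single_of_mem (f s) (hf s) fun b _ hb => h0 b hb] at h1
    simp [pureRule, ha, h1]
  · simp [pureRule, ha, h0 a ha]

/-! ### Agent optimality and costs -/

lemma objective_eq_totalReward (M : MDP S A AP) (N : ℕ) (Γ : Incentives S A) (k : ℕ)
    (π : Policy M) (s : S) :
    objective M N Γ k π s =
      totalReward M (fun t s a => M.reward s a + (Γ (k * N + t) s a : ℝ)) N π s := rfl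

/-- By `optimal_iff`, optimality constrains only which state-action pairs occur with positive
probability, and smaller supports make fewer of them occur. -/
lemma AgentOptimal.of_support {M : MDP S A AP} {N : ℕ} {Γ : Incentives S A} {π π' : Policy M}
    (hπ : AgentOptimal M N Γ π) (h : ∀ t s a, 0 < (π' t).prob s a → 0 < (π t).prob s a) :
    AgentOptimal M N Γ π' := by
  intro k
  obtain ⟨V, hV⟩ := exists_isValueFn M N
    (fun t s a => M.reward s a + (Γ (k * N + t) s a : ℝ))
  have h1 := (hV.optimal_iff _).1 (hπ k)
  exact (hV.optimal_iff _).2 fun s j hj s' a ho =>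
    h1 s j hj s' a (occupancy_pos_of_support (fun t s a => h _ s a) ho)

lemma cost_eq_tsum_expect (M : MDP S A AP) (Γ : Incentives S A) (π : Policy M) :
    cost M Γ π =
      ∑' t, ENNReal.ofReal (expect M π M.init t (fun s a => (Γ t s a : ℝ))) := by
  unfold cost expect
  refine tsum_congr fun t => ?_
  have hnn : ∀ s a, 0 ≤ occupancy M π M.init t s a * (Γ t s a : ℝ) := fun s a =>
    mul_nonneg (occupancy_nonneg ..) (Γ t s a).2
  rw [ENNReal.ofReal_sum_of_nonneg fun s _ => Finset.sum_nonneg fun a _ => hnn s a]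
  refine Finset.sum_congr rfl fun s _ => ?_
  rw [ENNReal.ofReal_sum_of_nonneg fun a _ => hnn s a]
  refine Finset.sum_congr rfl fun a _ => ?_
  rw [ENNReal.ofReal_mul (occupancy_nonneg ..), ENNReal.ofReal_coe_nnreal]

lemma sum_expect_le_cost {M : MDP S A AP} {Γ : Incentives S A} {π : Policy M}
    (h : cost M Γ π ≠ ∞) (n : ℕ) :
    ∑ t ∈ Finset.range n, expect M π M.init t (fun s a => (Γ t s a : ℝ)) ≤
      (cost M Γ π).toReal := by
  have hnn : ∀ t ∈ Finset.range n, 0 ≤ expect M π M.init t (fun s a => (Γ t s a : ℝ)) :=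
    fun t _ => expect_nonneg _ _ _ _ fun s a _ => (Γ t s a).2
  rw [← ENNReal.ofReal_le_iff_le_toReal h, ENNReal.ofReal_sum_of_nonneg hnn, cost_eq_tsum_expect]
  exact ENNReal.sum_le_tsum _

lemma cost_le_of_sum_expect_le {M : MDP S A AP} {Γ : Incentives S A} {π : Policy M} {C : ℝ}
    (h : ∀ n, ∑ t ∈ Finset.range n, expect M π M.init t (fun s a => (Γ t s a : ℝ)) ≤ C) :
    cost M Γ π ≤ ENNReal.ofReal C := by
  have hnn : ∀ t, 0 ≤ expect M π M.init t (fun s a => (Γ t s a : ℝ)) :=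
    fun t => expect_nonneg _ _ _ _ fun s a _ => (Γ t s a).2
  rw [cost_eq_tsum_expect, ENNReal.tsum_eq_iSup_nat]
  refine iSup_le fun n => ?_
  rw [← ENNReal.ofReal_sum_of_nonneg fun t _ => hnn t]
  exact ENNReal.ofReal_le_ofReal (h n)

/-- A finite infimum is strictly smaller than itself plus `ε`, so some feasible design has cost
below that bound. -/
lemma exists_isEpsOptimal {M : MDP S A AP} {N : ℕ} {E : Set (ℕ → S)} {ε : ℝ} (hε : 0 < ε)
    {Γ : Incentives S A} (hf : Feasible M N E Γ) (hc : designCost M N Γ ≠ ∞) :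
    ∃ Γ', IsEpsOptimal M N E ε Γ' := by
  have hle : optimalCost M N E ≤ designCost M N Γ := iInf₂_le Γ hf
  have hfin : optimalCost M N E ≠ ∞ := ne_top_of_le_ne_top hc hle
  have hlt : optimalCost M N E < optimalCost M N E + ENNReal.ofReal ε :=
    ENNReal.lt_add_right hfin (by simpa using hε)
  unfold optimalCost at hlt
  simp only [iInf_lt_iff] at hlt
  obtain ⟨Γ', hΓ', h⟩ := hlt
  exact ⟨Γ', hΓ', ne_top_of_lt h, h.le⟩

/-! ### Cylinders and the path measure -/

-- The trajectory measure is the projective limit of its finite-horizon marginals, and such a limit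
-- is unique.
open MeasureTheory ProbabilityTheory in
lemma eq_traj_apply {X : ℕ → Type*} [∀ n, MeasurableSpace (X n)]
    (κ : (n : ℕ) → Kernel (Π i : Finset.Iic n, X i) (X (n + 1))) [∀ n, IsMarkovKernel (κ n)]
    (x : Π i : Finset.Iic 0, X i) (ν : Measure (Π n, X n))
    (h : ∀ b, ν.map (Preorder.frestrictLe b) = Kernel.partialTraj κ 0 b x) :
    ν = Kernel.traj κ 0 x := by
  refine ((Kernel.isProjectiveLimit_trajFun κ 0 x).unique ?_).symm
  rw [isProjectiveLimit_nat_iff (Kernel.isProjectiveMeasureFamily_partialTraj κ x)]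
  intro n
  rw [inducedFamily_Iic, h]

/-- The state sequences that agree with `w` up to index `t`. -/
def prefixCyl {S : Type*} (t : ℕ) (w : ℕ → S) : Set (ℕ → S) := {ω | ∀ i ≤ t, ω i = w i}

lemma measurableSet_prefixCyl {S : Type*} [MeasurableSpace S] [DiscreteMeasurableSpace S]
    (t : ℕ) (w : ℕ → S) : MeasurableSet (prefixCyl t w) := by
  have : prefixCyl t w = ⋂ i ∈ Finset.Iic t, (fun ω : ℕ → S => ω i) ⁻¹' {w i} := by
    ext ω; simp [prefixCyl]
  rw [this]
  exact Finset.measurableSet_biInter _ fun i _ => measurable_pi_apply i (.of_discrete)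

lemma preimage_frestrictLe_singleton {S : Type*} (t : ℕ) (w : ℕ → S) :
    Preorder.frestrictLe (π := fun _ : ℕ => S) t ⁻¹' {Preorder.frestrictLe t w} =
      prefixCyl t w := by
  ext ω
  simp only [Set.mem_preimage, Set.mem_singleton_iff, prefixCyl, Set.mem_ofPred_eq, funext_iff,
    Preorder.frestrictLe_apply, Subtype.forall, Finset.mem_Iic]

section

variable [MeasurableSpace S] [DiscreteMeasurableSpace S]

instance (M : MDP S A AP) (π : Policy M) : MeasureTheory.IsProbabilityMeasure (pathMeasure M π) := by
  unfold pathMeasure; infer_instance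

lemma pathKernel_apply_singleton (M : MDP S A AP) (π : Policy M) (t : ℕ)
    (h : (i : Finset.Iic t) → (fun _ : ℕ => S) i) (s' : S) :
    pathKernel M π t h {s'} =
      ENNReal.ofReal (stepProb M (π t) (h ⟨t, Finset.mem_Iic.2 le_rfl⟩) s') := by
  unfold pathKernel
  rw [ProbabilityTheory.Kernel.comap_apply]
  change (nextState M (π t) (h ⟨t, Finset.mem_Iic.2 le_rfl⟩)).toMeasure {s'} = _
  rw [PMF.toMeasure_apply_singleton _ _ (.of_discrete)]
  rfl

open MeasureTheory ProbabilityTheory in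
lemma partialTraj_succ_singleton (κ : (n : ℕ) → Kernel ((i : Finset.Iic n) → (fun _ : ℕ => S) i) S)
    [∀ n, IsMarkovKernel (κ n)] (x : (i : Finset.Iic 0) → (fun _ : ℕ => S) i) (t : ℕ)
    (w : ℕ → S) :
    Kernel.partialTraj (X := fun _ : ℕ => S) κ 0 (t + 1) x {Preorder.frestrictLe (t + 1) w} =
      Kernel.partialTraj (X := fun _ : ℕ => S) κ 0 t x {Preorder.frestrictLe t w} *
        κ t (Preorder.frestrictLe t w) {w (t + 1)} := by
  rw [Kernel.partialTraj_succ_of_le (Nat.zero_le t),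
    Kernel.map_apply' _ (by fun_prop) _ (.of_discrete)]
  -- The condition on the one new coordinate; it turns the preimage of the singleton into a
  -- rectangle.
  let B : Set ((i : Finset.Ioc t (t + 1)) → (fun _ : ℕ => S) i) :=
    {y | y ⟨t + 1, Finset.mem_Ioc.2 ⟨by omega, le_rfl⟩⟩ = w (t + 1)}
  have hpre : IicProdIoc (X := fun _ : ℕ => S) t (t + 1) ⁻¹' {Preorder.frestrictLe (t + 1) w} =
      {Preorder.frestrictLe t w} ×ˢ B := by
    ext ⟨h, y⟩
    simp only [Set.mem_preimage, Set.mem_singleton_iff, Set.mem_prod, B, Set.mem_ofPred_eq,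
      funext_iff, Subtype.forall, Finset.mem_Iic, IicProdIoc, Preorder.frestrictLe_apply]
    constructor
    · intro hall
      refine ⟨fun i hi => ?_, ?_⟩
      · have := hall i (by omega)
        rwa [dif_pos hi] at this
      · have := hall (t + 1) le_rfl
        rwa [dif_neg (by omega)] at this
    · rintro ⟨h1, h2⟩ i hi
      by_cases hit : i ≤ t
      · rw [dif_pos hit, h1 i hit]
      · obtain rfl : i = t + 1 := by omega
        rw [dif_neg hit, h2]
  rw [hpre, Kernel.comp_apply' _ _ _ (.prod (.of_discrete) (.of_discrete))]
  have : ∀ b, (Kernel.id ×ₖ (κ t).map (MeasurableEquiv.piSingleton (X := fun _ : ℕ => S) t)) b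
      ({Preorder.frestrictLe t w} ×ˢ B) =
      Set.indicator {Preorder.frestrictLe t w}
        (fun _ => κ t (Preorder.frestrictLe t w) {w (t + 1)}) b := by
    intro b
    have := Kernel.IsMarkovKernel.map (κ t)
      (MeasurableEquiv.piSingleton (X := fun _ : ℕ => S) t).measurable
    have hB : MeasurableEquiv.piSingleton (X := fun _ : ℕ => S) t ⁻¹' B = {w (t + 1)} := rfl
    rw [Kernel.prod_apply_prod, Kernel.id_apply,
      Kernel.map_apply' _ (by fun_prop) _ (.of_discrete), Measure.dirac_apply' _ (.of_discrete), hB]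
    by_cases hb : b = Preorder.frestrictLe t w
    · simp [hb]
    · simp [hb]
  simp_rw [this]
  rw [lintegral_indicator_const (.of_discrete), mul_comm]

open MeasureTheory ProbabilityTheory in
lemma pathMeasure_prefixCyl_eq (M : MDP S A AP) (π : Policy M) (t : ℕ) (w : ℕ → S) :
    pathMeasure M π (prefixCyl t w) =
      Kernel.partialTraj (X := fun _ : ℕ => S) (fun t => pathKernel M π t) 0 t
        (fun _ => M.init) {Preorder.frestrictLe t w} := by
  rw [← Kernel.traj_map_frestrictLe_apply, Measure.map_apply (by fun_prop) (.of_discrete),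
    preimage_frestrictLe_singleton]
  rfl

open Classical in
lemma pathMeasure_prefixCyl_zero (M : MDP S A AP) (π : Policy M) (w : ℕ → S) :
    pathMeasure M π (prefixCyl 0 w) = if w 0 = M.init then 1 else 0 := by
  rw [pathMeasure_prefixCyl_eq, ProbabilityTheory.Kernel.partialTraj_self,
    ProbabilityTheory.Kernel.id_apply, MeasureTheory.Measure.dirac_apply' _ (.of_discrete)]
  simp only [Set.indicator, Set.mem_singleton_iff, Pi.one_apply, funext_iff, Subtype.forall,
    Preorder.frestrictLe_apply, Finset.mem_Iic, Nat.le_zero, forall_eq, eq_comm (a := M.init)]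

lemma pathMeasure_prefixCyl_succ (M : MDP S A AP) (π : Policy M) (t : ℕ) (w : ℕ → S) :
    pathMeasure M π (prefixCyl (t + 1) w) =
      pathMeasure M π (prefixCyl t w) *
        ENNReal.ofReal (stepProb M (π t) (w t) (w (t + 1))) := by
  rw [pathMeasure_prefixCyl_eq, pathMeasure_prefixCyl_eq, partialTraj_succ_singleton,
    pathKernel_apply_singleton]
  rfl

open Classical in
/-- The path measure is determined by its values on prefix cylinders. -/
lemma eq_pathMeasure (M : MDP S A AP) (π : Policy M) (ν : MeasureTheory.Measure (ℕ → S))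
    (h0 : ∀ w, ν (prefixCyl 0 w) = if w 0 = M.init then 1 else 0)
    (h1 : ∀ t w, ν (prefixCyl (t + 1) w) =
      ν (prefixCyl t w) * ENNReal.ofReal (stepProb M (π t) (w t) (w (t + 1)))) :
    ν = pathMeasure M π := by
  have hcyl : ∀ t w, ν (prefixCyl t w) = pathMeasure M π (prefixCyl t w) := by
    intro t w
    induction t with
    | zero => rw [h0, pathMeasure_prefixCyl_zero]
    | succ t ih => rw [h1, ih, pathMeasure_prefixCyl_succ]
  refine eq_traj_apply (X := fun _ : ℕ => S) _ _ _ fun b => ?_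
  refine MeasureTheory.Measure.ext_of_singleton fun h => ?_
  obtain ⟨w, rfl⟩ : ∃ w : ℕ → S, Preorder.frestrictLe (π := fun _ : ℕ => S) b w = h := by
    refine ⟨fun i => if hi : i ≤ b then h ⟨i, Finset.mem_Iic.2 hi⟩ else M.init, ?_⟩
    ext ⟨i, hi⟩
    simp [Finset.mem_Iic.1 hi]
  rw [MeasureTheory.Measure.map_apply (by fun_prop) (.of_discrete),
    preimage_frestrictLe_singleton, hcyl, pathMeasure_prefixCyl_eq]

/-- A prefix ending in `w t` is one of the ways to be in `w t`. Used to discard cylinders that end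
in unvisited states. -/
lemma pathMeasure_prefixCyl_le (M : MDP S A AP) (π : Policy M) (t : ℕ) (w : ℕ → S) :
    pathMeasure M π (prefixCyl t w) ≤ ENNReal.ofReal (stateProb M π M.init t (w t)) := by
  classical
  induction t with
  | zero =>
    rw [pathMeasure_prefixCyl_zero]
    simp only [stateProb]
    split_ifs <;> simp
  | succ t ih =>
    rw [pathMeasure_prefixCyl_succ]
    refine (mul_le_mul_left ih _).trans ?_
    rw [← ENNReal.ofReal_mul (stateProb_nonneg ..)]
    exact ENNReal.ofReal_le_ofReal (Finset.single_le_sum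
      (f := fun s => stateProb M π M.init t s * stepProb M (π t) s (w (t + 1)))
      (fun s _ => mul_nonneg (stateProb_nonneg ..) (stepProb_nonneg ..)) (Finset.mem_univ (w t)))

/-- Policies that agree on the states visited by the first of them generate the same paths. -/
lemma pathMeasure_congr {M : MDP S A AP} {π π' : Policy M}
    (h : ∀ t s, 0 < stateProb M π M.init t s → (π t).prob s = (π' t).prob s) :
    pathMeasure M π = pathMeasure M π' := by
  classical
  refine eq_pathMeasure M π' _ (pathMeasure_prefixCyl_zero M π) fun t w => ?_
  rw [pathMeasure_prefixCyl_succ]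
  rcases (stateProb_nonneg M π M.init t (w t)).eq_or_lt with h0 | h0
  · have := pathMeasure_prefixCyl_le M π t w
    rw [← h0, ENNReal.ofReal_zero, nonpos_iff_eq_zero] at this
    rw [this, zero_mul, zero_mul]
  · rw [stepProb, stepProb, h t _ h0]

end

lemma pathProb_congr {M : MDP S A AP} {π π' : Policy M}
    (h : ∀ t s, 0 < stateProb M π M.init t s → (π t).prob s = (π' t).prob s)
    (E : Set (ℕ → S)) : pathProb M π E = pathProb M π' E := by
  let _ : MeasurableSpace S := ⊤
  have _ : DiscreteMeasurableSpace S := ⟨fun _ => trivial⟩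
  change pathMeasure M π E = pathMeasure M π' E
  rw [pathMeasure_congr h]

/-! ### Extensions of an MDP by a deterministic memory -/

/-- The path of the extended process that starts in `g₀ (ω 0)` and is updated by `F`. -/
def memoryPath {X : Type*} (g₀ : S → X) (F : X → S → X) (ω : ℕ → S) : ℕ → X
  | 0 => g₀ (ω 0)
  | t + 1 => F (memoryPath g₀ F ω t) (ω (t + 1))

lemma memoryPath_congr {S X : Type*} (g₀ : S → X) (F : X → S → X) {ω ω' : ℕ → S} (t : ℕ)
    (h : ∀ i ≤ t, ω i = ω' i) : memoryPath g₀ F ω t = memoryPath g₀ F ω' t := by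
  induction t with
  | zero => simp [memoryPath, h 0 le_rfl]
  | succ t ih => simp only [memoryPath, ih fun i hi => h i (by omega), h (t + 1) le_rfl]

/-- `X` extends the process of `M` by a memory that is updated deterministically. -/
structure IsMemoryExtension {X AP' : Type*} [Fintype X] (M : MDP S A AP) (M' : MDP X A AP')
    (p : X → S) (g₀ : S → X) (F : X → S → X) : Prop where
  proj_start : ∀ s, p (g₀ s) = s
  proj_update : ∀ x s, p (F x s) = s
  init : M'.init = g₀ M.init
  avail : ∀ x, M'.avail x = M.avail (p x)
  trans_update : ∀ x a s, M'.trans x a (F x s) = M.trans (p x) a s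
  trans_eq_zero : ∀ x a x', x' ≠ F x (p x') → M'.trans x a x' = 0
  reward : ∀ x a, M'.reward x a = M.reward (p x) a

namespace IsMemoryExtension

variable {X AP' : Type*} [Fintype X] {M : MDP S A AP} {M' : MDP X A AP'}
  {p : X → S} {g₀ : S → X} {F : X → S → X}

/-- A decision rule that ignores the memory. -/
def liftRule (h : IsMemoryExtension M M' p g₀ F) (d : DecisionRule M) : DecisionRule M' where
  prob x a := d.prob (p x) a
  prob_mem x a := d.prob_mem (p x) a
  prob_eq_zero x a ha := d.prob_eq_zero (p x) a (by rwa [← h.avail])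
  sum_prob x := by rw [h.avail]; exact d.sum_prob (p x)

lemma sum_trans_mul (h : IsMemoryExtension M M' p g₀ F) (x : X) (a : A) (f : X → ℝ) :
    ∑ x', M'.trans x a x' * f x' = ∑ s, M.trans (p x) a s * f (F x s) := by
  classical
  have hinj : Function.Injective (F x) := fun s s' e => by
    rw [← h.proj_update x s, e, h.proj_update]
  rw [← Finset.sum_subset (Finset.subset_univ (Finset.univ.image (F x))),
    Finset.sum_image hinj.injOn]
  · exact Finset.sum_congr rfl fun s _ => by rw [h.trans_update]
  · intro x' _ hx'
    rw [h.trans_eq_zero x a x', zero_mul]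
    exact fun e => hx' (by rw [e]; exact Finset.mem_image_of_mem _ (Finset.mem_univ _))

lemma stepProb_update (h : IsMemoryExtension M M' p g₀ F) (d : DecisionRule M) (x : X) (s : S) :
    stepProb M' (h.liftRule d) x (F x s) = stepProb M d (p x) s := by
  simp only [stepProb, h.avail, h.trans_update, liftRule]

lemma stepProb_eq_zero (h : IsMemoryExtension M M' p g₀ F) (d : DecisionRule M') {x x' : X}
    (hx : x' ≠ F x (p x')) : stepProb M' d x x' = 0 :=
  Finset.sum_eq_zero fun a _ => by rw [h.trans_eq_zero x a x' hx, mul_zero]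

/-- When decisions ignore the memory, the projected process is the process of `M` itself. -/
lemma expect_lift (h : IsMemoryExtension M M' p g₀ F) (σ : Policy M) (t : ℕ) (x : X)
    (f : S → A → ℝ) :
    expect M' (fun t => h.liftRule (σ t)) x t (fun x a => f (p x) a) =
      expect M σ (p x) t f := by
  have aux : ∀ (π : Policy M') (t : ℕ) (f : S → A → ℝ), (π t = h.liftRule (σ t)) →
      expect M' π x t (fun x a => f (p x) a) =
        ∑ y, stateProb M' π x t y * ∑ a ∈ M.avail (p y), (σ t).prob (p y) a * f (p y) a := by
    intro π t f hπ
    simp only [expect, occupancy_eq, hπ, h.avail, Finset.mul_sum, mul_assoc, liftRule]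
  -- The induction needs every test function `V`, since one step replaces `V` by its expected next
  -- value.
  have key : ∀ (t : ℕ) (V : S → ℝ),
      ∑ y, stateProb M' (fun t => h.liftRule (σ t)) x t y * V (p y) =
        ∑ s, stateProb M σ (p x) t s * V s := by
    intro t
    induction t with
    | zero => intro V; classical simp [stateProb]
    | succ t ih =>
      intro V
      rw [← expect_next M' _ x t (fun y => V (p y)), ← expect_next M σ (p x) t V]
      simp only [h.sum_trans_mul, h.proj_update]
      rw [aux _ t (fun s a => ∑ s', M.trans s a s' * V s') rfl,
        ih (fun s => ∑ a ∈ M.avail s, (σ t).prob s a * ∑ s', M.trans s a s' * V s')]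
      simp only [expect, occupancy_eq, Finset.mul_sum, mul_assoc]
  rw [aux _ t f rfl, key t (fun s => ∑ a ∈ M.avail s, (σ t).prob s a * f s a)]
  simp only [expect, occupancy_eq, Finset.mul_sum, mul_assoc]

lemma proj_memoryPath (h : IsMemoryExtension M M' p g₀ F) (ω : ℕ → S) (t : ℕ) :
    p (memoryPath g₀ F ω t) = ω t := by
  cases t with
  | zero => exact h.proj_start _
  | succ t => exact h.proj_update _ _

/-- The memory is a function of the path, so an extended prefix that is realized at all is
equivalent to its projection. -/
lemma memoryPath_preimage (h : IsMemoryExtension M M' p g₀ F) {ω₀ : ℕ → S} {t : ℕ} {w : ℕ → X}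
    (hω : memoryPath g₀ F ω₀ ∈ prefixCyl t w) :
    memoryPath g₀ F ⁻¹' prefixCyl t w = prefixCyl t (fun i => p (w i)) := by
  ext ω
  constructor
  · intro hm i hi
    change ω i = p (w i)
    rw [← hm i hi, h.proj_memoryPath]
  · intro hm i hi
    rw [← hω i hi]
    refine memoryPath_congr _ _ _ fun j hj => ?_
    rw [hm j (hj.trans hi)]
    change p (w j) = _
    rw [← hω j (hj.trans hi), h.proj_memoryPath]

section

variable [MeasurableSpace S] [DiscreteMeasurableSpace S] [MeasurableSpace X]
  [DiscreteMeasurableSpace X]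

lemma measurable_memoryPath (g₀ : S → X) (F : X → S → X) : Measurable (memoryPath g₀ F) := by
  refine measurable_pi_lambda _ fun t => ?_
  induction t with
  | zero => exact (measurable_of_countable g₀).comp (measurable_pi_apply 0)
  | succ t ih =>
    exact (measurable_of_countable (fun y : X × S => F y.1 y.2)).comp
      (ih.prodMk (measurable_pi_apply (t + 1)))

/-- Both laws are compared on prefix cylinders: consistent prefixes have the same step
probabilities, and those violating the memory update have measure zero on both sides. -/
lemma map_pathMeasure (h : IsMemoryExtension M M' p g₀ F) (σ : Policy M) :
    (pathMeasure M σ).map (memoryPath g₀ F) =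
      pathMeasure M' (fun t => h.liftRule (σ t)) := by
  classical
  have hmap : ∀ t w, (pathMeasure M σ).map (memoryPath g₀ F) (prefixCyl t w) =
      pathMeasure M σ (memoryPath g₀ F ⁻¹' prefixCyl t w) := fun t w =>
    MeasureTheory.Measure.map_apply (measurable_memoryPath g₀ F) (measurableSet_prefixCyl t w)
  refine eq_pathMeasure _ _ _ (fun w => ?_) fun t w => ?_
  · rw [hmap]
    by_cases hw : w 0 = g₀ (p (w 0))
    · rw [h.memoryPath_preimage (ω₀ := fun i => p (w i))
        (fun i hi => by obtain rfl := Nat.le_zero.1 hi; exact hw.symm),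
        pathMeasure_prefixCyl_zero, h.init]
      refine if_congr ⟨fun e => by rw [hw, e], fun e => by rw [e, h.proj_start]⟩ rfl rfl
    · rw [if_neg fun e => hw (by rw [e, h.init, h.proj_start])]
      convert MeasureTheory.measure_empty (μ := pathMeasure M σ)
      refine Set.eq_empty_of_forall_notMem fun ω hω => hw ?_
      rw [← hω 0 le_rfl, h.proj_memoryPath]; rfl
  · rw [hmap, hmap]
    rcases Set.eq_empty_or_nonempty (memoryPath g₀ F ⁻¹' prefixCyl t w) with he | ⟨ω₀, hω₀⟩
    · have : memoryPath g₀ F ⁻¹' prefixCyl (t + 1) w ⊆ memoryPath g₀ F ⁻¹' prefixCyl t w :=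
        fun ω hω i hi => hω i (by omega)
      rw [he, Set.subset_empty_iff] at this
      rw [he, this, MeasureTheory.measure_empty, zero_mul]
    · by_cases hw : w (t + 1) = F (w t) (p (w (t + 1)))
      · let ω₁ : ℕ → S := fun i => p (w i)
        have hω₁ : memoryPath g₀ F ω₁ ∈ prefixCyl t w := by
          have : ω₁ ∈ prefixCyl t (fun i => p (w i)) := fun i _ => rfl
          rwa [← h.memoryPath_preimage hω₀] at this
        have hω₂ : memoryPath g₀ F ω₁ ∈ prefixCyl (t + 1) w := by
          intro i hi
          rcases Nat.le_succ_iff.1 hi with hi | rfl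
          · exact hω₁ i hi
          · rw [hw, memoryPath, hω₁ t le_rfl]
        rw [h.memoryPath_preimage hω₁, h.memoryPath_preimage hω₂, pathMeasure_prefixCyl_succ, hw,
          h.stepProb_update, h.proj_update]
      · rw [h.stepProb_eq_zero _ hw, ENNReal.ofReal_zero, mul_zero]
        convert MeasureTheory.measure_empty (μ := pathMeasure M σ)
        refine Set.eq_empty_of_forall_notMem fun ω hω => hw ?_
        rw [← hω (t + 1) le_rfl, ← hω t (by omega), h.proj_memoryPath]; rfl

end

lemma pathProb_lift (h : IsMemoryExtension M M' p g₀ F) (σ : Policy M) {B : Set X} :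
    pathProb M' (fun t => h.liftRule (σ t)) (reachPaths B) =
      pathProb M σ {ω | ∃ t, memoryPath g₀ F ω t ∈ B} := by
  let _ : MeasurableSpace S := ⊤
  have _ : DiscreteMeasurableSpace S := ⟨fun _ => trivial⟩
  let _ : MeasurableSpace X := ⊤
  have _ : DiscreteMeasurableSpace X := ⟨fun _ => trivial⟩
  change pathMeasure M' (fun t => h.liftRule (σ t)) (reachPaths B) = pathMeasure M σ _
  have hB : MeasurableSet (reachPaths B) := by
    have : reachPaths B = ⋃ t, (fun ω : ℕ → X => ω t) ⁻¹' B := by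
      ext ω; simp [reachPaths]
    rw [this]
    exact .iUnion fun t => measurable_pi_apply t (.of_discrete)
  rw [← h.map_pathMeasure,
    MeasureTheory.Measure.map_apply (measurable_memoryPath g₀ F) hB]
  rfl

end IsMemoryExtension

/-! ### Steering the agent along a deterministic plan -/

open Classical in
/-- The incentives that compensate the agent for the loss caused by the plan `d` with respect to
the value function `V` of the process without incentives, plus a geometrically decreasing bonus. -/
def compensation (M : MDP S A AP) (N : ℕ) (V : ℕ → S → ℝ) (d : ℕ → S → A) : Incentives S A :=
  fun t s a => if a = d t s then
    (IsValueFn.gap M (fun _ => M.reward) V (t % N) s a).toNNReal + (1 / 2) ^ t else 0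

lemma block_mod {N j : ℕ} (hj : j < N) (k : ℕ) : (k * N + j) % N = j := by
  rw [add_comm, Nat.add_mul_mod_self_right, Nat.mod_eq_of_lt hj]

lemma compensation_plan {M : MDP S A AP} {N : ℕ} {V : ℕ → S → ℝ} {d : ℕ → S → A}
    (hd : ∀ t s, d t s ∈ M.avail s) (hV : IsValueFn M (fun _ => M.reward) N V) (hN : 0 < N)
    (t : ℕ) (s : S) :
    (compensation M N V d t s (d t s) : ℝ) =
      IsValueFn.gap M (fun _ => M.reward) V (t % N) s (d t s) + (1 / 2) ^ t := by
  simp [compensation, Real.coe_toNNReal _ (hV.gap_nonneg (Nat.mod_lt t hN) s _ (hd t s))]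

lemma compensation_of_ne {M : MDP S A AP} {N : ℕ} {V : ℕ → S → ℝ} {d : ℕ → S → A} {t : ℕ} {s : S}
    {a : A} (h : a ≠ d t s) : (compensation M N V d t s a : ℝ) = 0 := by
  simp [compensation, h]

/-- The value function of a block under the compensating incentives. -/
def compensatedValue (N : ℕ) (V : ℕ → S → ℝ) (k j : ℕ) (s : S) : ℝ :=
  V j s + ∑ i ∈ Finset.Ico j N, (1 / 2 : ℝ) ^ (k * N + i)

/-- The tail of bonuses does not depend on the state, so it passes through the transition average
and only the current bonus survives in the difference. -/
lemma gap_compensatedValue {M : MDP S A AP} {N : ℕ} (V : ℕ → S → ℝ) (Γ : Incentives S A)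
    (k : ℕ) {j : ℕ} (hj : j < N) {s : S} {a : A} (ha : a ∈ M.avail s) :
    IsValueFn.gap M (fun t s a => M.reward s a + (Γ (k * N + t) s a : ℝ))
        (compensatedValue N V k) j s a =
      IsValueFn.gap M (fun _ => M.reward) V j s a + (1 / 2) ^ (k * N + j) - Γ (k * N + j) s a := by
  simp only [IsValueFn.gap, compensatedValue, mul_add, Finset.sum_add_distrib, ← Finset.sum_mul,
    M.sum_trans s a ha, Finset.sum_eq_sum_Ico_succ_bot hj]
  ring

/-- Under the compensating incentives, the agent follows the plan. -/
lemma AgentOptimal.eq_plan {M : MDP S A AP} {N : ℕ} {V : ℕ → S → ℝ} {d : ℕ → S → A}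
    (hd : ∀ t s, d t s ∈ M.avail s) (hV : IsValueFn M (fun _ => M.reward) N V) (hN : 0 < N)
    {σ : Policy M} (hσ : AgentOptimal M N (compensation M N V d) σ) {s₀ : S} {t : ℕ} {s : S} {a : A}
    (ho : 0 < occupancy M σ s₀ t s a) : a = d t s := by
  -- The compensation cancels the planned action's gap, while any other action forfeits at least the
  -- bonus. This makes `compensatedValue` the value function, with the plan as unique maximizer.
  have hplan : ∀ k, ∀ j < N, ∀ s,
      IsValueFn.gap M (fun t s a => M.reward s a + (compensation M N V d (k * N + t) s a : ℝ))
        (compensatedValue N V k) j s (d (k * N + j) s) = 0 := fun k j hj s => by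
    rw [gap_compensatedValue V _ k hj (hd _ s), compensation_plan hd hV hN, block_mod hj]
    ring
  have hother : ∀ k, ∀ j < N, ∀ s, ∀ a ∈ M.avail s, a ≠ d (k * N + j) s →
      0 < IsValueFn.gap M (fun t s a => M.reward s a + (compensation M N V d (k * N + t) s a : ℝ))
        (compensatedValue N V k) j s a := fun k j hj s a ha hne => by
    rw [gap_compensatedValue V _ k hj ha, compensation_of_ne hne]
    rw [sub_zero]
    exact add_pos_of_nonneg_of_pos (hV.gap_nonneg hj s a ha) (by positivity)
  have hW : ∀ k, IsValueFn M
      (fun t s a => M.reward s a + (compensation M N V d (k * N + t) s a : ℝ)) N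
      (compensatedValue N V k) := by
    refine fun k => ⟨fun s => by simp [compensatedValue, hV.terminal], fun j hj s a ha => ?_,
      fun j hj s => ⟨d (k * N + j) s, hd _ s, ?_⟩⟩
    · have h1 := hplan k j hj s
      by_cases hne : a = d (k * N + j) s
      · rw [← hne] at h1; unfold IsValueFn.gap at h1; linarith
      · have h2 := hother k j hj s a ha hne
        unfold IsValueFn.gap at h2; linarith
    · have h1 := hplan k j hj s
      unfold IsValueFn.gap at h1; linarith
  -- Split the stage into block and position: some state `x` at the start of the block leads to `(s,
  -- a)` with positive probability, and optimality from `x` applies.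
  have ht : t / N * N + t % N = t := Nat.div_add_mod' t N
  have hmod := Nat.mod_lt t hN
  rw [← ht, occupancy_add] at ho
  obtain ⟨x, -, hx⟩ := Finset.exists_ne_zero_of_sum_ne_zero ho.ne'
  have hocc := (occupancy_nonneg M (fun i => σ (t / N * N + i)) x (t % N) s a).lt_of_ne'
    (right_ne_zero_of_mul hx)
  have hgap := ((hW (t / N)).optimal_iff _).1 (hσ (t / N)) x (t % N) hmod s a hocc
  by_contra hne
  rw [← ht] at hne
  exact (hother _ _ hmod s a (mem_avail_of_prob_pos _ ((occupancy_pos_iff ..).1 hocc).2) hne).ne'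
    hgap

lemma sum_range_mul_le {f g : ℕ → ℝ} {N : ℕ}
    (h : ∀ k, ∑ j ∈ Finset.range N, f (k * N + j) ≤ ∑ j ∈ Finset.range N, g (k * N + j)) (K : ℕ) :
    ∑ t ∈ Finset.range (K * N), f t ≤ ∑ t ∈ Finset.range (K * N), g t := by
  induction K with
  | zero => simp
  | succ K ih =>
    rw [Nat.succ_mul, Finset.sum_range_add, Finset.sum_range_add]
    exact add_le_add ih (h K)

/-- The cost of the compensating incentives, if the losses of the plan are bounded over every block
by the amounts `g`. -/
lemma cost_compensation_le {M : MDP S A AP} {N : ℕ} {V : ℕ → S → ℝ} {d : ℕ → S → A}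
    (hd : ∀ t s, d t s ∈ M.avail s) (hV : IsValueFn M (fun _ => M.reward) N V) (hN : 0 < N)
    {g : ℕ → ℝ} {C : ℝ} (hg : ∀ n, ∑ t ∈ Finset.range n, g t ≤ C)
    (h : ∀ k, ∑ j ∈ Finset.range N, expect M (fun t => pureRule M (d t) (hd t)) M.init (k * N + j)
        (IsValueFn.gap M (fun _ => M.reward) V j) ≤ ∑ j ∈ Finset.range N, g (k * N + j)) :
    cost M (compensation M N V d) (fun t => pureRule M (d t) (hd t)) ≤ ENNReal.ofReal (C + 2) := by
  set δ : Policy M := fun t => pureRule M (d t) (hd t) with hδ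
  refine cost_le_of_sum_expect_le fun n => ?_
  have h1 : ∀ t, expect M δ M.init t (fun s a => (compensation M N V d t s a : ℝ)) =
      expect M δ M.init t (IsValueFn.gap M (fun _ => M.reward) V (t % N)) + (1 / 2) ^ t := by
    intro t
    rw [← expect_const M δ M.init t ((1 / 2) ^ t), ← expect_add]
    refine expect_congr _ _ _ _ fun s a ho => ?_
    obtain rfl := pureRule_pos ((occupancy_pos_iff ..).1 ho).2
    exact compensation_plan hd hV hN t s
  have h2 : ∀ t, 0 ≤ expect M δ M.init t (IsValueFn.gap M (fun _ => M.reward) V (t % N)) :=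
    fun t => expect_nonneg _ _ _ _ (hV.gap_nonneg (Nat.mod_lt t hN))
  simp only [h1, Finset.sum_add_distrib]
  -- The constant `2` bounds the bonuses; the gaps are then bounded by completing the range to `n`
  -- full blocks, which only adds nonnegative terms.
  refine add_le_add ?_ (sum_geometric_two_le n)
  calc ∑ t ∈ Finset.range n, expect M δ M.init t (IsValueFn.gap M (fun _ => M.reward) V (t % N))
      ≤ ∑ t ∈ Finset.range (n * N),
          expect M δ M.init t (IsValueFn.gap M (fun _ => M.reward) V (t % N)) :=
        Finset.sum_le_sum_of_subset_of_nonneg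
          (Finset.range_mono (Nat.le_mul_of_pos_right n hN)) fun t _ _ => h2 t
    _ ≤ ∑ t ∈ Finset.range (n * N), g t := by
        refine sum_range_mul_le (fun k => ?_) n
        refine le_of_eq_of_le (Finset.sum_congr rfl fun j hj => ?_) (h k)
        rw [block_mod (Finset.mem_range.1 hj)]
    _ ≤ C := hg _

namespace IsMemoryExtension

variable {X AP' : Type*} [Fintype X] {M : MDP S A AP} {M' : MDP X A AP'}
  {p : X → S} {g₀ : S → X} {F : X → S → X}

/-- If the memory is determined by the state and the stage along an optimal policy of the agent,
then there is an optimal policy that follows a deterministic plan without memory. -/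
lemma exists_plan (h : IsMemoryExtension M M' p g₀ F) {N : ℕ} {Γ : Incentives X A} {π : Policy M'}
    (hπ : AgentOptimal M' N Γ π)
    (hinj : ∀ t x y, 0 < stateProb M' π M'.init t x → 0 < stateProb M' π M'.init t y →
      p x = p y → x = y) :
    ∃ (d : ℕ → S → A) (hd : ∀ t s, d t s ∈ M.avail s) (π' : Policy M'), AgentOptimal M' N Γ π' ∧
      ∀ t x, 0 < stateProb M' π' M'.init t x →
        (π' t).prob x = (h.liftRule (pureRule M (d t) (hd t))).prob x := by
  classical
  -- At most one occupied `x` lies over `s`, so one action serves all of them; if there is none, any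
  -- available action will do.
  have hex : ∀ t s, ∃ a, a ∈ M.avail s ∧
      ∀ x, p x = s → 0 < stateProb M' π M'.init t x → 0 < (π t).prob x a := by
    intro t s
    by_cases hs : ∃ x, p x = s ∧ 0 < stateProb M' π M'.init t x
    · obtain ⟨x, rfl, hx⟩ := hs
      obtain ⟨a, ha⟩ := (π t).exists_prob_pos x
      refine ⟨a, by rw [← h.avail]; exact mem_avail_of_prob_pos _ ha, fun y hy hy' => ?_⟩
      rwa [hinj t y x hy' hx hy]
    · obtain ⟨a, ha⟩ := M.avail_nonempty s
      exact ⟨a, ha, fun x hx hx' => absurd ⟨x, hx, hx'⟩ hs⟩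
  choose d hd hsupp using hex
  let L : Policy M' := fun t => h.liftRule (pureRule M (d t) (hd t))
  -- Off the occupied states `π` is kept: the agent must be optimal from every starting state, and
  -- the planned action need not be in the support of `π` there.
  let π' : Policy M' := fun t =>
    { prob := fun x => if 0 < stateProb M' π M'.init t x then (L t).prob x else (π t).prob x
      prob_mem := fun x a => by split_ifs <;> exact DecisionRule.prob_mem _ x a
      prob_eq_zero := fun x a ha => by split_ifs <;> exact DecisionRule.prob_eq_zero _ x a ha
      sum_prob := fun x => by split_ifs <;> exact DecisionRule.sum_prob _ x }
  have hsub : ∀ t x a, 0 < (π' t).prob x a → 0 < (π t).prob x a := by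
    intro t x a hpos
    by_cases hx : 0 < stateProb M' π M'.init t x
    · simp only [π', if_pos hx] at hpos
      obtain rfl : a = d t (p x) := pureRule_pos (hf := hd t) hpos
      exact hsupp t (p x) x rfl hx
    · simpa only [π', if_neg hx] using hpos
  refine ⟨d, hd, π', hπ.of_support hsub, fun t x hx => ?_⟩
  simp only [π', if_pos (stateProb_pos_of_support hsub _ t x hx)]
  rfl

/-- Whatever the incentives, the agent gets at least the optimal value without incentives. -/
lemma value_le_objective (h : IsMemoryExtension M M' p g₀ F) {N : ℕ} {Γ : Incentives X A}
    {V : ℕ → S → ℝ} (hV : IsValueFn M (fun _ => M.reward) N V) {π : Policy M'}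
    (hπ : AgentOptimal M' N Γ π) (k : ℕ) (x : X) :
    V 0 (p x) ≤ objective M' N Γ k (fun t => π (k * N + t)) x := by
  obtain ⟨f, hf, hg⟩ := hV.exists_greedy
  let σ : Policy M := fun t => pureRule M (f t) (hf t)
  have hσ : totalReward M (fun _ => M.reward) N σ (p x) = V 0 (p x) := by
    refine hV.totalReward_of_gap_eq_zero fun j hj s a ho => ?_
    rw [pureRule_pos ((occupancy_pos_iff ..).1 ho).2, hg j hj]
  -- The competitor is the incentive-free greedy policy lifted to `M'`; incentives only add to its
  -- payoff.
  refine le_trans ?_ (hπ k x (fun t => h.liftRule (σ t)))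
  rw [← hσ, objective_eq_totalReward]
  refine Finset.sum_le_sum fun t _ => ?_
  rw [← h.expect_lift σ t x M.reward,
    expect_add M' _ x t M'.reward (fun s a => (Γ (k * N + t) s a : ℝ))]
  have h1 : M'.reward = fun x a => M.reward (p x) a := by
    ext x a; exact h.reward x a
  rw [h1]
  exact le_add_of_nonneg_right (expect_nonneg _ _ _ _ fun s a _ => (Γ (k * N + t) s a).2)

/-- Over every block, the losses caused by the plan are at most the incentives paid on `M'`. -/
lemma sum_gap_le (h : IsMemoryExtension M M' p g₀ F) {N : ℕ} {Γ : Incentives X A}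
    {V : ℕ → S → ℝ} (hV : IsValueFn M (fun _ => M.reward) N V) {π : Policy M'}
    (hπ : AgentOptimal M' N Γ π) {δ : Policy M}
    (hδ : ∀ t x, 0 < stateProb M' π M'.init t x → (π t).prob x = (h.liftRule (δ t)).prob x)
    (k : ℕ) :
    ∑ j ∈ Finset.range N, expect M δ M.init (k * N + j)
        (IsValueFn.gap M (fun _ => M.reward) V j) ≤
      ∑ j ∈ Finset.range N, expect M' π M'.init (k * N + j)
        (fun x a => (Γ (k * N + j) x a : ℝ)) := by
  have hproj : ∀ t (f : S → A → ℝ),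
      expect M' π M'.init t (fun x a => f (p x) a) = expect M δ M.init t f := by
    intro t f
    have h1 : M.init = p M'.init := by rw [h.init, h.proj_start]
    rw [h1, ← h.expect_lift δ t]
    simp only [expect, occupancy_congr hδ]
  have hlhs : ∑ j ∈ Finset.range N, expect M δ M.init (k * N + j)
        (IsValueFn.gap M (fun _ => M.reward) V j) =
      expect M δ M.init (k * N) (fun s _ => V 0 s) -
        ∑ j ∈ Finset.range N, expect M δ M.init (k * N + j) M.reward := by
    have h1 := sum_expect_potential M δ M.init (k * N) N V
    simp only [hV.terminal, mul_zero, Finset.sum_const_zero, sub_zero] at h1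
    rw [expect_state M δ M.init (k * N) (V 0), ← h1, ← Finset.sum_sub_distrib]
    exact Finset.sum_congr rfl fun j _ => expect_sub ..
  -- Average the lower bound on the agent's objective over the distribution of the state at the
  -- start of block `k`.
  have hrhs : expect M δ M.init (k * N) (fun s _ => V 0 s) ≤
      ∑ j ∈ Finset.range N, expect M δ M.init (k * N + j) M.reward +
      ∑ j ∈ Finset.range N, expect M' π M'.init (k * N + j)
        (fun x a => (Γ (k * N + j) x a : ℝ)) := by
    have h1 : M'.reward = fun x a => M.reward (p x) a := by
      ext x a; exact h.reward x a
    rw [← hproj (k * N) (fun s _ => V 0 s), expect_state M' π M'.init (k * N) (fun x => V 0 (p x)),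
      ← Finset.sum_add_distrib]
    simp only [← hproj _ M.reward, ← expect_add]
    simp only [expect_stage_add M' π M'.init (k * N)]
    rw [Finset.sum_comm]
    refine Finset.sum_le_sum fun x _ => ?_
    rw [← Finset.mul_sum]
    refine mul_le_mul_of_nonneg_left ?_ (stateProb_nonneg ..)
    have h2 := h.value_le_objective hV hπ k x
    rw [objective_eq_totalReward, totalReward, h1] at h2
    exact h2
  rw [hlhs]
  linarith

/-- A feasible design of finite cost on the extension `M'` gives one on `M`, if the memory is
determined by the state and the stage along an optimal policy of the agent. -/
lemma exists_feasible (h : IsMemoryExtension M M' p g₀ F) {N : ℕ} (hN : 0 < N)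
    {E : Set (ℕ → S)} {E' : Set (ℕ → X)}
    (hE : ∀ σ : Policy M, pathProb M' (fun t => h.liftRule (σ t)) E' = pathProb M σ E)
    {Γ : Incentives X A} (hf : Feasible M' N E' Γ) (hc : designCost M' N Γ ≠ ∞)
    {π : Policy M'} (hπ : AgentOptimal M' N Γ π)
    (hinj : ∀ t x y, 0 < stateProb M' π M'.init t x → 0 < stateProb M' π M'.init t y →
      p x = p y → x = y) :
    ∃ Γ' : Incentives S A, Feasible M N E Γ' ∧ designCost M N Γ' ≠ ∞ := by
  obtain ⟨d, hd, π', hπ', hagree⟩ := h.exists_plan hπ hinj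
  obtain ⟨V, hV⟩ := exists_isValueFn M N (fun _ => M.reward)
  have hplan : ∀ σ : Policy M, AgentOptimal M N (compensation M N V d) σ →
      ∀ t s, 0 < stateProb M σ M.init t s → (σ t).prob s = (pureRule M (d t) (hd t)).prob s :=
    fun σ hσ t s hs => prob_eq_pureRule _ fun a ha =>
      hσ.eq_plan hd hV hN ((occupancy_pos_iff ..).2 ⟨hs, ha⟩)
  refine ⟨compensation M N V d, fun σ hσ τ => ?_, ?_⟩
  -- An optimal `σ` generates the paths of the plan, whose lift generates those of `π'`; feasibility
  -- on `M'` compares `π'` with the lift of `τ`.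
  · rw [pathProb_congr (hplan σ hσ) E, ← hE, ← hE, ← pathProb_congr hagree E']
    exact hf π' hπ' _
  · have hcost : cost M' Γ π' ≠ ∞ := ne_top_of_le_ne_top hc (le_iSup₂ (f := fun (π : Policy M')
      (_ : AgentOptimal M' N Γ π) => cost M' Γ π) π' hπ')
    refine ne_top_of_le_ne_top (ENNReal.ofReal_ne_top (r := (cost M' Γ π').toReal + 2))
      (iSup₂_le fun σ hσ => ?_)
    rw [cost_congr _ (hplan σ hσ)]
    exact cost_compensation_le hd hV hN (fun n => sum_expect_le_cost hcost n)
      (h.sum_gap_le hV hπ' hagree)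

end IsMemoryExtension

/-! ### The product MDP as a memory extension -/

lemma counterStep_iff {N : ℕ} [NeZero N] (n n' : Fin N) : CounterStep n n' ↔ n' = n + 1 := by
  have hN := NeZero.pos N
  rw [CounterStep, Fin.ext_iff, Fin.val_add, Fin.val_one', Nat.add_mod_mod]
  rcases (Nat.succ_le_of_lt n.isLt).lt_or_eq with h | h
  · rw [Nat.mod_eq_of_lt h]; omega
  · have h' : n.val + 1 = N := h
    rw [h', Nat.mod_self]; omega

lemma isMemoryExtension_product (M : MDP S A AP) (N : ℕ) [NeZero N] (D : DFA (Set AP) Q) :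
    IsMemoryExtension M (product (expanded M N) D) (fun x => x.1.1)
      (fun s => ((s, 0), D.step D.start (M.label s)))
      (fun x s => ((s, x.1.2 + 1), D.step x.2 (M.label s))) where
  proj_start _ := rfl
  proj_update _ _ := rfl
  init := rfl
  avail _ := rfl
  trans_update x a s := by simp [product, expanded, counterStep_iff]
  trans_eq_zero x a x' hx := by
    by_cases h1 : x'.2 = D.step x.2 (M.label x'.1.1)
    · exact (if_pos h1).trans (if_neg fun h2 =>
        hx (Prod.ext (Prod.ext rfl ((counterStep_iff _ _).1 h2)) h1))
    · exact if_neg h1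
  reward _ _ := rfl

/-- The counter is a function of the stage, so at a fixed stage each state of `M` occurs with only
one counter value. -/
lemma counter_eq_of_stateProb_pos {M : MDP S A AP} {N : ℕ} [NeZero N] {D : DFA (Set AP) Q}
    {π : Policy (product (expanded M N) D)} {t : ℕ} {x : (S × Fin N) × Q}
    (hx : 0 < stateProb _ π (product (expanded M N) D).init t x) : x.1.2 = Fin.ofNat N t := by
  induction t generalizing x with
  | zero =>
    by_cases hx0 : x = (product (expanded M N) D).init
    · rw [hx0]; rfl
    · simp [stateProb, hx0] at hx
  | succ t ih =>
    obtain ⟨y, -, hy⟩ := Finset.exists_ne_zero_of_sum_ne_zero hx.ne'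
    have h1 := ih ((stateProb_nonneg ..).lt_of_ne' (left_ne_zero_of_mul hy))
    have h2 : x = _ := not_imp_comm.1
      ((isMemoryExtension_product M N D).stepProb_eq_zero (π t)) (right_ne_zero_of_mul hy)
    rw [h2]
    simp only [h1]
    ext
    simp [Fin.val_add]

lemma mem_occupiedMemory_iff {M : MDP S A AP} {D : DFA (Set AP) Q} {π : Policy (product M D)}
    {s : S} {t : ℕ} {q : Q} :
    q ∈ occupiedMemory M D π s t ↔ 0 < stateProb _ π (product M D).init t (s, q) := by
  rw [← sum_occupancy]; rfl

/-- At index `t` the automaton has read `t + 1` letters, because the initial product state already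
contains the label of the first state. -/
lemma memoryPath_product {S A AP Q : Type*} [Fintype S] (M : MDP S A AP) (N : ℕ) [NeZero N] (D : DFA (Set AP) Q) (ω : ℕ → S)
    (t : ℕ) :
    (memoryPath (fun s => ((s, (0 : Fin N)), D.step D.start (M.label s)))
      (fun x s => ((s, x.1.2 + 1), D.step x.2 (M.label s))) ω t).2 =
      D.eval ((List.range (t + 1)).map fun i => M.label (ω i)) := by
  induction t with
  | zero => simp [memoryPath, DFA.eval]
  | succ t ih =>
    rw [List.range_succ, List.map_append, memoryPath, ih]
    simp

/-- The product never tests the empty prefix, so reaching acceptance matches satisfaction only if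
the start state is not accepting. -/
lemma setOf_memoryPath_mem_accept {S A AP Q : Type*} [Fintype S] {M : MDP S A AP} {N : ℕ} [NeZero N] {φ : ScLTL AP}
    {D : DFA (Set AP) Q} (hD : IsDFAOf D φ) (hstart : D.start ∉ D.accept) :
    {ω | ∃ t, memoryPath (fun s => ((s, (0 : Fin N)), D.step D.start (M.label s)))
      (fun x s => ((s, x.1.2 + 1), D.step x.2 (M.label s))) ω t ∈
        acceptStates (S × Fin N) D} = satPaths M φ := by
  ext ω
  change (∃ t, _ ∈ D.accept) ↔ φ.Sat _
  rw [hD]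
  simp only [memoryPath_product]
  constructor
  · rintro ⟨t, ht⟩
    exact ⟨t + 1, ht⟩
  · rintro ⟨_ | t, ht⟩
    · exact absurd ht hstart
    · exact ⟨t, ht⟩

lemma pathProb_univ (M : MDP S A AP) (π : Policy M) : pathProb M π Set.univ = 1 := by
  let _ : MeasurableSpace S := ⊤
  have _ : DiscreteMeasurableSpace S := ⟨fun _ => trivial⟩
  exact MeasureTheory.measure_univ (μ := pathMeasure M π)

end IncentiveDesign

end

open IncentiveDesign in
theorem theorem2 {S A AP Q : Type*} [Fintype S] [Fintype A] [Fintype Q]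
    (M : MDP S A AP) (N : ℕ) [NeZero N]
    (φ : ScLTL AP) (D : DFA (Set AP) Q) (hD : IsDFAOf D φ)
    (ε : ℝ) (hε : 0 < ε)
    (h : ∃ Γ : Incentives ((S × Fin N) × Q) A,
      IsEpsOptimal (product (expanded M N) D) N (reachPaths (acceptStates (S × Fin N) D)) ε Γ ∧
      ∃ π : Policy (product (expanded M N) D),
        AgentOptimal (product (expanded M N) D) N Γ π ∧
        ∀ (s : S × Fin N) (t : ℕ), (occupiedMemory (expanded M N) D π s t).ncard ≤ 1) :
    ∃ Γ : Incentives S A, IsEpsOptimal M N (satPaths M φ) ε Γ := by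
  obtain ⟨Γ, ⟨hf, hc, -⟩, π, hπ, hmem⟩ := h
  suffices h : ∃ Γ' : Incentives S A, Feasible M N (satPaths M φ) Γ' ∧ designCost M N Γ' ≠ ∞ by
    obtain ⟨Γ', hf', hc'⟩ := h
    exact exists_isEpsOptimal hε hf' hc'
  -- If the empty prefix is accepted, every path satisfies `φ`, and zero incentives are feasible at
  -- no cost.
  by_cases hstart : D.start ∈ D.accept
  · have huniv : satPaths M φ = Set.univ :=
      Set.eq_univ_of_forall fun ω => (hD _).2 ⟨0, hstart⟩
    refine ⟨fun _ _ _ => 0, fun π _ σ => ?_, ?_⟩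
    · rw [huniv, pathProb_univ, pathProb_univ]
    · simp [designCost, cost]
  · have hext := isMemoryExtension_product M N D
    refine hext.exists_feasible (NeZero.pos N) (fun σ => ?_) hf hc hπ ?_
    · rw [hext.pathProb_lift, setOf_memoryPath_mem_accept hD hstart]
    · rintro t ⟨⟨s, n⟩, q⟩ ⟨⟨s', n'⟩, q'⟩ hx hy (rfl : s = s')
      obtain rfl : n = n' := (counter_eq_of_stateProb_pos hx).trans
        (counter_eq_of_stateProb_pos hy).symm
      have := (Set.ncard_le_one (Set.toFinite _)).1 (hmem (s, n) t) q
        (mem_occupiedMemory_iff.2 hx) q' (mem_occupiedMemory_iff.2 hy)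
      rw [this]
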